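/- Let $n\ge 1$, $s\in(0,\tfrac12)$ and $0<\lambda\le\Lambda$. There is a constant $C$, depending only on $n,s,\lambda,\Lambda$, such that the following holds. Let $K:\mathbb R^n\to\mathbb R$ be a measurable kernel with $K(y)=K(-y)$ and $\lambda|y|^{-n-2s}\le K(y)\le\Lambda|y|^{-n-2s}$ for $y\neq 0$, and let $Lu(x)=\int_{\mathbb R^n}\big(u(x)-u(x+y)\big)K(y)\,dy$. Let $T>0$, let $\varphi\in C^{0,1}_c(\mathbb R^n)$ (Lipschitz with compact support), and let $u$ be a bounded, continuous viscosity solution on $\mathbb R^n\times[0,T)$ of the parabolic obstacle problem $$\min\{\partial_t u+Lu,\;u-\varphi\}=0\ \text{ in }\ \mathbb R^n\times(0,T),\qquad u(\cdot,0)=\varphi\ \text{ in }\ \mathbb R^n .$$ Here "viscosity solution" means: whenever $\psi\in C^2(\mathbb R^n\times\mathbb R)$ touches $u$ from above (respectively below) at $(x_0,t_0)$ in a cylinder $B_r(x_0)\times(t_0-r,t_0+r)\subset\mathbb R^n\times(0,T)$, one has $\min\{\partial_t\psi(x_0,t_0)+Lv(x_0),\,u(x_0,t_0)-\varphi(x_0)\}\le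 0$ (respectively $\ge 0$), where $v=\psi(\cdot,t_0)$ in $B_r(x_0)$ and $v=u(\cdot,t_0)$ outside $B_r(x_0)$. Then $u$ is globally Lipschitz in $\mathbb R^n\times(0,T)$ (hence differentiable almost everywhere there), and $$\|\nabla_x u\|_{L^\infty(\mathbb R^n\times(0,T))}\le\|\varphi\|_{C^{0,1}(\mathbb R^n)},\qquad \|u_t\|_{L^\infty(\mathbb R^n\times(0,T))}\le C\,\|\varphi\|_{C^{0,1}(\mathbb R^n)},$$ where $\|\varphi\|_{C^{0,1}(\mathbb R^n)}=\sup|\varphi|+\sup_{x\ne y}\frac{|\varphi(x)-\varphi(y)|}{|x-y|}$. -/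

import Mathlib

open MeasureTheory Set Metric
open scoped NNReal ENNReal

noncomputable section

/-- Kernels `K` on `ℝⁿ` that are even and comparable to `|y|^(-n-2s)`, with ellipticity constants
`lam` and `Lam`. The value at the origin plays no role. -/
structure IsEllipticKernel (n : ℕ) (s lam Lam : ℝ) (K : EuclideanSpace ℝ (Fin n) → ℝ) : Prop where
  measurable : Measurable K
  even : ∀ y, K (-y) = K y
  lower : ∀ y, y ≠ 0 → lam * ‖y‖ ^ (-(n : ℝ) - 2 * s) ≤ K y
  upper : ∀ y, y ≠ 0 → K y ≤ Lam * ‖y‖ ^ (-(n : ℝ) - 2 * s)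

/-- `L v (x) = ∫ (v(x) - v(x+y)) K(y) dy`. -/
def nonlocalOp {n : ℕ} (K v : EuclideanSpace ℝ (Fin n) → ℝ) (x : EuclideanSpace ℝ (Fin n)) : ℝ :=
  ∫ y, (v x - v (x + y)) * K y

/-- The function `x ↦ ψ(x, t)` inside `B_r(x₀)` and `x ↦ u(x, t)` outside of it. -/
def glue {n : ℕ} (u : EuclideanSpace ℝ (Fin n) → ℝ → ℝ) (ψ : EuclideanSpace ℝ (Fin n) × ℝ → ℝ)
    (x₀ : EuclideanSpace ℝ (Fin n)) (r t : ℝ) : EuclideanSpace ℝ (Fin n) → ℝ :=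
  fun x => if dist x x₀ < r then ψ (x, t) else u x t

/-- The obstacle operator `min {∂ₜψ + L v, u - φ}` at `(x₀, t₀)`, where `v` is the test function `ψ`
in `B_r(x₀)` and `u` outside of it. -/
def obstacleOp {n : ℕ} (K φ : EuclideanSpace ℝ (Fin n) → ℝ) (u : EuclideanSpace ℝ (Fin n) → ℝ → ℝ)
    (ψ : EuclideanSpace ℝ (Fin n) × ℝ → ℝ) (x₀ : EuclideanSpace ℝ (Fin n)) (t₀ r : ℝ) : ℝ :=
  min (deriv (fun t => ψ (x₀, t)) t₀ + nonlocalOp K (glue u ψ x₀ r t₀) x₀) (u x₀ t₀ - φ x₀)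

/-- `min {∂ₜu + L u, u - φ} ≤ 0` in `ℝⁿ × (0,T)` in the viscosity sense: the inequality holds for
every `C²` test function touching `u` from above. -/
def IsViscositySubsolution {n : ℕ} (K φ : EuclideanSpace ℝ (Fin n) → ℝ) (T : ℝ)
    (u : EuclideanSpace ℝ (Fin n) → ℝ → ℝ) : Prop :=
  ∀ (x₀ : EuclideanSpace ℝ (Fin n)) (t₀ r : ℝ) (ψ : EuclideanSpace ℝ (Fin n) × ℝ → ℝ),
    0 < r → 0 ≤ t₀ - r → t₀ + r ≤ T → ContDiff ℝ 2 ψ →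
    (∀ x ∈ ball x₀ r, ∀ t ∈ Ioo (t₀ - r) (t₀ + r), u x t ≤ ψ (x, t)) →
    ψ (x₀, t₀) = u x₀ t₀ →
    obstacleOp K φ u ψ x₀ t₀ r ≤ 0

/-- `min {∂ₜu + L u, u - φ} ≥ 0` in `ℝⁿ × (0,T)` in the viscosity sense: the inequality holds for
every `C²` test function touching `u` from below. -/
def IsViscositySupersolution {n : ℕ} (K φ : EuclideanSpace ℝ (Fin n) → ℝ) (T : ℝ)
    (u : EuclideanSpace ℝ (Fin n) → ℝ → ℝ) : Prop :=
  ∀ (x₀ : EuclideanSpace ℝ (Fin n)) (t₀ r : ℝ) (ψ : EuclideanSpace ℝ (Fin n) × ℝ → ℝ),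
    0 < r → 0 ≤ t₀ - r → t₀ + r ≤ T → ContDiff ℝ 2 ψ →
    (∀ x ∈ ball x₀ r, ∀ t ∈ Ioo (t₀ - r) (t₀ + r), ψ (x, t) ≤ u x t) →
    ψ (x₀, t₀) = u x₀ t₀ →
    0 ≤ obstacleOp K φ u ψ x₀ t₀ r

/-- (Bounded, continuous) viscosity solutions of the parabolic obstacle problem
`min {∂ₜu + L u, u - φ} = 0` in `ℝⁿ × (0,T)`, `u(·,0) = φ`. -/
structure IsViscositySolution {n : ℕ} (K φ : EuclideanSpace ℝ (Fin n) → ℝ) (T : ℝ)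
    (u : EuclideanSpace ℝ (Fin n) → ℝ → ℝ) : Prop where
  continuousOn : ContinuousOn (fun p : EuclideanSpace ℝ (Fin n) × ℝ => u p.1 p.2)
    (univ ×ˢ Ico 0 T)
  bounded : ∃ M : ℝ, ∀ x, ∀ t ∈ Ico 0 T, |u x t| ≤ M
  sub : IsViscositySubsolution K φ T u
  super : IsViscositySupersolution K φ T u
  initial : ∀ x, u x 0 = φ x

/-- `‖φ‖_{C^{0,1}(ℝⁿ)} = sup |φ| + sup_{x ≠ y} |φ(x) - φ(y)| / |x - y|`
(the diagonal contributes `0 / 0 = 0`). -/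
def c01Norm {n : ℕ} (φ : EuclideanSpace ℝ (Fin n) → ℝ) : ℝ≥0∞ :=
  (⨆ x, ‖φ x‖ₑ) + ⨆ x, ⨆ y, ‖φ x - φ y‖ₑ / ‖x - y‖ₑ

/-- The space `C^{0,1}_c(ℝⁿ)` of compactly supported Lipschitz functions. -/
def MemC01c {n : ℕ} (φ : EuclideanSpace ℝ (Fin n) → ℝ) : Prop :=
  (∃ M : ℝ≥0, LipschitzWith M φ) ∧ HasCompactSupport φ

/-- The measure on `ℝⁿ × ℝ` given by Lebesgue measure on `ℝⁿ × (0,T)`. -/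
def cylMeasure (n : ℕ) (T : ℝ) : Measure (EuclideanSpace ℝ (Fin n) × ℝ) :=
  volume.restrict (univ ×ˢ Ioo 0 T)

end

open Filter Topology

/-! Doubling of variables. With `S` and `P` the supremum and Lipschitz bounds of `φ`, and `A = S +
P`, one compares `u x t - u y τ` with `N (x - y) + m (t - τ)`, where `N` is a smoothed cone of slope
`A` that saturates at height `2 * A`, and `m` is a smoothed multiple of the positive part of time.

Suppose the comparison fails. Penalties `f` at spatial infinity and `g` near time `T` make the
difference attain a positive maximum at some `(x, t)`, `(y, τ)`. Since `N (x - y)` dominates `φ x -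
φ y` and `u ≥ φ`, the point `(x, t)` lies off the contact set, so the equation's inequality holds
there and `t > 0`; the supersolution inequality is available at `(y, τ)` when `τ > 0`. In that case
both time derivatives contain the same `m'`, which cancels, and shifting `x` and `y` by one vector
does not change `N`. The nonlocal terms then differ only by small errors, which the positive
derivative of `g` beats.

If `τ = 0`, only the inequality at `(x, t)` is available. There `s < 1/2` enters decisively: the
kernel has a finite truncated first moment, so the operator is bounded on functions with increments
at most `A * min ‖y‖ 2`, and the slope of `m` is chosen to exceed that bound. This yields the time
constant, linear in `A`.

The argument is `IsViscositySolution.sub_le_smoothCone_add`; compactness is `exists_doubled_max`,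
the obstacle enters through `le_smoothCone`, and `IsViscositySolution.abs_sub_le` removes the
smoothing. -/

/-! ### Integrals against the weight and the kernel -/

/-- The weight `|y|^(-n-2s)`. -/
noncomputable def fracWeight (n : ℕ) (s : ℝ) (y : EuclideanSpace ℝ (Fin n)) : ℝ :=
  ‖y‖ ^ (-(n : ℝ) - 2 * s)

theorem fracWeight_nonneg (n : ℕ) (s : ℝ) (y : EuclideanSpace ℝ (Fin n)) :
    0 ≤ fracWeight n s y := Real.rpow_nonneg (norm_nonneg _) _

theorem measurable_fracWeight (n : ℕ) (s : ℝ) : Measurable (fracWeight n s) :=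
  measurable_norm.pow_const _

/-- In polar coordinates the integrand is `t ^ (-2 * s)` near zero, integrable since `s < 1/2`, and
at most `2 * t ^ (-1 - 2 * s)` at infinity, integrable since `s > 0`. -/
theorem integrable_min_norm_mul_fracWeight {n : ℕ} (hn : 1 ≤ n) {s : ℝ}
    (hs : s ∈ Ioo (0 : ℝ) (1 / 2)) :
    Integrable (fun y : EuclideanSpace ℝ (Fin n) => min ‖y‖ 2 * fracWeight n s y) := by
  have : Nontrivial (EuclideanSpace ℝ (Fin n)) := by
    apply Module.nontrivial_of_finrank_pos (R := ℝ)
    simp; omega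
  obtain ⟨hs0, hs1⟩ := hs
  have h := integrable_fun_norm_addHaar (volume : Measure (EuclideanSpace ℝ (Fin n)))
    (f := fun t : ℝ => min t 2 * t ^ (-(n : ℝ) - 2 * s))
  refine h.2 ?_
  rw [finrank_euclideanSpace_fin]
  have key : ∀ t ∈ Ioi (0 : ℝ), t ^ (n - 1) • (min t 2 * t ^ (-(n : ℝ) - 2 * s))
      = min t 2 * t ^ (-1 - 2 * s) := by
    intro t ht
    rw [smul_eq_mul, ← Real.rpow_natCast t (n - 1), mul_left_comm, ← Real.rpow_add ht]
    congr 2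
    push_cast [Nat.cast_sub hn]
    ring
  rw [integrableOn_congr_fun key measurableSet_Ioi, ← Ioc_union_Ioi_eq_Ioi (zero_le_one' ℝ)]
  refine IntegrableOn.union ?_ ?_
  · have hi : IntegrableOn (fun t : ℝ => t ^ (-2 * s)) (Ioc 0 1) :=
      (intervalIntegrable_iff_integrableOn_Ioc_of_le zero_le_one).1
        (intervalIntegral.intervalIntegrable_rpow' (by linarith))
    refine (integrableOn_congr_fun (fun t ht => ?_) measurableSet_Ioc).1 hi
    have ht0 : 0 < t := ht.1
    simp only [min_eq_left (ht.2.trans one_le_two)]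
    nth_rewrite 2 [← Real.rpow_one t]
    rw [← Real.rpow_add ht0]
    congr 1; ring
  · have hi : IntegrableOn (fun t : ℝ => 2 * t ^ (-1 - 2 * s)) (Ioi 1) :=
      (integrableOn_Ioi_rpow_of_lt (by linarith) zero_lt_one).const_mul 2
    refine Integrable.mono' hi ?_ ?_
    · exact Measurable.aestronglyMeasurable (by fun_prop)
    · filter_upwards [ae_restrict_mem measurableSet_Ioi] with t ht
      have ht0 : (0 : ℝ) < t := zero_lt_one.trans ht
      have h0 : 0 ≤ t ^ (-1 - 2 * s) := Real.rpow_nonneg ht0.le _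
      have h1 : 0 ≤ min t 2 := le_min ht0.le zero_le_two
      rw [Real.norm_eq_abs, abs_of_nonneg (mul_nonneg h1 h0)]
      exact mul_le_mul_of_nonneg_right (min_le_right _ _) h0

/-- If `h i → 0` pointwise and the `h i` are dominated by `min |y| 2`, then their integrals
against the weight `|y|^(-n-2s)` tend to zero. -/
theorem tendsto_integral_mul_fracWeight {n : ℕ} (hn : 1 ≤ n) {s : ℝ}
    (hs : s ∈ Ioo (0 : ℝ) (1 / 2)) {h : ℝ → EuclideanSpace ℝ (Fin n) → ℝ}
    (hm : ∀ r, Measurable (h r)) (h0 : ∀ r, 0 < r → ∀ y, 0 ≤ h r y)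
    (hle : ∀ r, 0 < r → r ≤ 1 → ∀ y, h r y ≤ min ‖y‖ 2)
    (hlim : ∀ y, y ≠ 0 → Tendsto (fun r => h r y) (𝓝[>] 0) (𝓝 0)) :
    Tendsto (fun r => ∫ y, h r y * fracWeight n s y) (𝓝[>] 0) (𝓝 0) := by
  have : Nontrivial (EuclideanSpace ℝ (Fin n)) := by
    apply Module.nontrivial_of_finrank_pos (R := ℝ)
    simp; omega
  have h1 : ∀ᶠ r : ℝ in 𝓝[>] 0, r ∈ Ioc (0 : ℝ) 1 := Ioc_mem_nhdsGT zero_lt_one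
  have := tendsto_integral_filter_of_dominated_convergence (l := 𝓝[>] (0 : ℝ))
    (μ := (volume : Measure (EuclideanSpace ℝ (Fin n))))
    (F := fun r y => h r y * fracWeight n s y) (f := fun _ => (0 : ℝ))
    (fun y => min ‖y‖ 2 * fracWeight n s y)
    (Eventually.of_forall fun r =>
      ((hm r).mul (measurable_fracWeight n s)).aestronglyMeasurable)
    (by
      filter_upwards [h1] with r hr
      refine Eventually.of_forall fun y => ?_
      rw [Real.norm_eq_abs, abs_of_nonneg (mul_nonneg (h0 r hr.1 y) (fracWeight_nonneg n s y))]
      exact mul_le_mul_of_nonneg_right (hle r hr.1 hr.2 y) (fracWeight_nonneg n s y))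
    (integrable_min_norm_mul_fracWeight hn hs)
    (by
      filter_upwards [compl_mem_ae_iff.2 (measure_singleton (0 : EuclideanSpace ℝ (Fin n)))]
        with y hy
      simpa using (hlim y hy).mul_const (fracWeight n s y))
  simpa using this

theorem integrable_mul_fracWeight {n : ℕ} (hn : 1 ≤ n) {s : ℝ} (hs : s ∈ Ioo (0 : ℝ) (1 / 2))
    {h : EuclideanSpace ℝ (Fin n) → ℝ} (hh : Measurable h) {c : ℝ} (h0 : ∀ y, 0 ≤ h y)
    (hc : ∀ y, h y ≤ c * min ‖y‖ 2) : Integrable (fun y => h y * fracWeight n s y) := by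
  refine Integrable.mono' ((integrable_min_norm_mul_fracWeight hn hs).const_mul c)
    (hh.mul (measurable_fracWeight n s)).aestronglyMeasurable (Eventually.of_forall fun y => ?_)
  rw [Real.norm_eq_abs, abs_of_nonneg (mul_nonneg (h0 y) (fracWeight_nonneg n s y)), ← mul_assoc]
  exact mul_le_mul_of_nonneg_right (hc y) (fracWeight_nonneg n s y)

section Kernel

variable {n : ℕ} {s lam Lam : ℝ} {K : EuclideanSpace ℝ (Fin n) → ℝ}

theorem IsEllipticKernel.ae_bound (hn : 1 ≤ n) (hK : IsEllipticKernel n s lam Lam K)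
    (hlam : 0 < lam) : ∀ᵐ y, 0 ≤ K y ∧ K y ≤ Lam * fracWeight n s y := by
  have : Nontrivial (EuclideanSpace ℝ (Fin n)) := by
    apply Module.nontrivial_of_finrank_pos (R := ℝ)
    simp; omega
  filter_upwards [compl_mem_ae_iff.2 (measure_singleton (0 : EuclideanSpace ℝ (Fin n)))]
    with y hy
  exact ⟨(mul_nonneg hlam.le (fracWeight_nonneg n s y)).trans (hK.lower y hy), hK.upper y hy⟩

theorem IsEllipticKernel.integrable_mul (hn : 1 ≤ n) (hs : s ∈ Ioo (0 : ℝ) (1 / 2))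
    (hK : IsEllipticKernel n s lam Lam K) (hlam : 0 < lam) {D : EuclideanSpace ℝ (Fin n) → ℝ}
    (hD : Measurable D) {c : ℝ} (hc : ∀ y, |D y| ≤ c * min ‖y‖ 2) :
    Integrable (fun y => D y * K y) := by
  refine Integrable.mono' ((integrable_min_norm_mul_fracWeight hn hs).const_mul (c * Lam))
    (hD.mul hK.measurable).aestronglyMeasurable ?_
  filter_upwards [hK.ae_bound hn hlam] with y hy
  rw [Real.norm_eq_abs, abs_mul, abs_of_nonneg hy.1]
  calc |D y| * K y ≤ (c * min ‖y‖ 2) * (Lam * fracWeight n s y) :=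
        mul_le_mul (hc y) hy.2 hy.1 ((abs_nonneg _).trans (hc y))
    _ = _ := by ring

theorem IsEllipticKernel.integral_mul_le (hn : 1 ≤ n) (hK : IsEllipticKernel n s lam Lam K)
    (hlam : 0 < lam) {D h : EuclideanSpace ℝ (Fin n) → ℝ}
    (hD : Integrable (fun y => D y * K y)) (hh : Integrable (fun y => h y * fracWeight n s y))
    (h0 : ∀ y, 0 ≤ h y) (hle : ∀ y, D y ≤ h y) :
    ∫ y, D y * K y ≤ Lam * ∫ y, h y * fracWeight n s y := by
  rw [← integral_const_mul]
  refine integral_mono_ae hD (hh.const_mul _) ?_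
  filter_upwards [hK.ae_bound hn hlam] with y hy
  calc D y * K y ≤ h y * K y := mul_le_mul_of_nonneg_right (hle y) hy.1
    _ ≤ h y * (Lam * fracWeight n s y) := mul_le_mul_of_nonneg_left hy.2 (h0 y)
    _ = _ := by ring

end Kernel

/-! ### Smooth penalties for the doubling argument -/

/-- The smooth regularisation `√(r² + ε²)` of `|r|`. -/
noncomputable def smoothAbs (ε r : ℝ) : ℝ := √(r ^ 2 + ε ^ 2)

theorem smoothAbs_pos {ε : ℝ} (hε : 0 < ε) (r : ℝ) : 0 < smoothAbs ε r :=
  Real.sqrt_pos.2 (by positivity)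

theorem abs_le_smoothAbs (ε r : ℝ) : |r| ≤ smoothAbs ε r :=
  Real.abs_le_sqrt (by nlinarith [sq_nonneg ε])

theorem smoothAbs_le {ε : ℝ} (hε : 0 < ε) (r : ℝ) : smoothAbs ε r ≤ |r| + ε := by
  refine Real.sqrt_le_iff.2 ⟨by positivity, ?_⟩
  nlinarith [abs_nonneg r, sq_abs r]

theorem abs_smoothAbs_sub_le {ε : ℝ} (hε : 0 < ε) (a b : ℝ) :
    |smoothAbs ε a - smoothAbs ε b| ≤ |a - b| := by
  have ha := smoothAbs_pos hε a
  have hb := smoothAbs_pos hε b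
  have hsum : 0 < smoothAbs ε a + smoothAbs ε b := by positivity
  have hA : smoothAbs ε a ^ 2 = a ^ 2 + ε ^ 2 := Real.sq_sqrt (by positivity)
  have hB : smoothAbs ε b ^ 2 = b ^ 2 + ε ^ 2 := Real.sq_sqrt (by positivity)
  have h1 : (smoothAbs ε a - smoothAbs ε b) * (smoothAbs ε a + smoothAbs ε b)
      = (a - b) * (a + b) := by nlinarith
  have h2 : |smoothAbs ε a - smoothAbs ε b| * (smoothAbs ε a + smoothAbs ε b)
      = |a - b| * |a + b| := by
    rw [← abs_mul, ← h1, abs_mul, abs_of_pos hsum]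
  have h3 : |a + b| ≤ smoothAbs ε a + smoothAbs ε b :=
    (abs_add_le a b).trans (add_le_add (abs_le_smoothAbs ε a) (abs_le_smoothAbs ε b))
  by_contra! h
  nlinarith [abs_nonneg (a - b), mul_le_mul_of_nonneg_left h3 (abs_nonneg (a - b)),
    mul_lt_mul_of_pos_right h hsum]

theorem hasDerivAt_smoothAbs {ε : ℝ} (hε : 0 < ε) (r : ℝ) :
    HasDerivAt (smoothAbs ε) (r / smoothAbs ε r) r := by
  have h : HasDerivAt (fun r : ℝ => r ^ 2 + ε ^ 2) (2 * r) r := by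
    simpa using (hasDerivAt_pow 2 r).add_const (ε ^ 2)
  have := h.sqrt (by positivity)
  rwa [mul_div_mul_left _ _ two_ne_zero] at this

theorem contDiff_smoothAbs {ε : ℝ} (hε : 0 < ε) : ContDiff ℝ 2 (smoothAbs ε) :=
  ContDiff.sqrt (by fun_prop) fun r => by positivity

/-- A smooth, bounded regularisation of the cone `A |z|`. -/
noncomputable def smoothCone {n : ℕ} (A ε : ℝ) (z : EuclideanSpace ℝ (Fin n)) : ℝ :=
  2 * A * smoothAbs ε ‖z‖ / (2 + smoothAbs ε ‖z‖)

section SmoothCone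

variable {n : ℕ} {A ε : ℝ}

theorem contDiff_smoothCone (hε : 0 < ε) :
    ContDiff ℝ 2 (smoothCone A ε : EuclideanSpace ℝ (Fin n) → ℝ) := by
  have h : ContDiff ℝ 2 (fun z : EuclideanSpace ℝ (Fin n) => smoothAbs ε ‖z‖) := by
    unfold smoothAbs
    exact ContDiff.sqrt ((contDiff_norm_sq ℝ).add contDiff_const) fun z => by positivity
  exact (contDiff_const.mul h).div (contDiff_const.add h) fun z => by
    have := smoothAbs_pos hε ‖z‖
    positivity

theorem smoothCone_nonneg (hA : 0 ≤ A) (hε : 0 < ε) (z : EuclideanSpace ℝ (Fin n)) :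
    0 ≤ smoothCone A ε z := by
  have := smoothAbs_pos hε ‖z‖
  unfold smoothCone
  positivity

theorem smoothCone_le (hA : 0 ≤ A) (hε : 0 < ε) (z : EuclideanSpace ℝ (Fin n)) :
    smoothCone A ε z ≤ A * (‖z‖ + ε) := by
  have h0 := smoothAbs_pos hε ‖z‖
  have h1 := smoothAbs_le hε ‖z‖
  rw [abs_norm] at h1
  refine le_trans ?_ (mul_le_mul_of_nonneg_left h1 hA)
  unfold smoothCone
  rw [div_le_iff₀ (by positivity)]
  nlinarith [mul_nonneg hA (sq_nonneg (smoothAbs ε ‖z‖))]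

/-- With `p = smoothAbs ε ‖z‖`, add `2 * a ≤ 2 * P * p` to `a * p ≤ 2 * S * p` and divide by `2 +
p`. Applied to `a = φ x - φ y`, this excludes contact with the obstacle at a doubled maximum. -/
theorem le_smoothCone (hε : 0 < ε) {S P a : ℝ} (hP : 0 ≤ P)
    {z : EuclideanSpace ℝ (Fin n)} (h1 : a ≤ 2 * S) (h2 : a ≤ P * ‖z‖) :
    a ≤ smoothCone (S + P) ε z := by
  have h0 := smoothAbs_pos hε ‖z‖
  have h3 := abs_le_smoothAbs ε ‖z‖
  rw [abs_norm] at h3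
  have h4 : a ≤ P * smoothAbs ε ‖z‖ := h2.trans (mul_le_mul_of_nonneg_left h3 hP)
  unfold smoothCone
  rw [le_div_iff₀ (by positivity)]
  nlinarith [mul_le_mul_of_nonneg_right h1 h0.le]

theorem abs_smoothCone_sub_le_norm (hA : 0 ≤ A) (hε : 0 < ε) (z w : EuclideanSpace ℝ (Fin n)) :
    |smoothCone A ε z - smoothCone A ε w| ≤ A * ‖z - w‖ := by
  have hp := smoothAbs_pos hε ‖z‖
  have hq := smoothAbs_pos hε ‖w‖
  have hpq := (abs_smoothAbs_sub_le hε ‖z‖ ‖w‖).trans (abs_norm_sub_norm_le z w)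
  unfold smoothCone
  set p := smoothAbs ε ‖z‖
  set q := smoothAbs ε ‖w‖
  have : 2 * A * p / (2 + p) - 2 * A * q / (2 + q)
      = A * (p - q) * (4 / ((2 + p) * (2 + q))) := by
    field_simp
    ring
  rw [this, abs_mul, abs_mul, abs_of_nonneg hA, abs_of_pos (by positivity : 0 < 4 / ((2 + p) * (2 + q)))]
  have h1 : 4 / ((2 + p) * (2 + q)) ≤ 1 := by
    rw [div_le_one (by positivity)]
    nlinarith [mul_pos hp hq]
  calc A * |p - q| * (4 / ((2 + p) * (2 + q))) ≤ A * |p - q| * 1 := by gcongr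
    _ ≤ A * ‖z - w‖ := by rw [mul_one]; gcongr

/-- The map `p ↦ 2 * A * p / (2 + p)` has slope at most `A` and values in `[0, 2 * A]`. The
truncation matches the integrable weight in `truncatedMoment`. -/
theorem abs_smoothCone_sub_le (hA : 0 ≤ A) (hε : 0 < ε) (z w : EuclideanSpace ℝ (Fin n)) :
    |smoothCone A ε z - smoothCone A ε w| ≤ A * min ‖z - w‖ 2 := by
  rw [mul_min_of_nonneg _ _ hA]
  refine le_min (abs_smoothCone_sub_le_norm hA hε z w) ?_
  have hle : ∀ z : EuclideanSpace ℝ (Fin n), smoothCone A ε z ≤ A * 2 := fun z => by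
    have hp := smoothAbs_pos hε ‖z‖
    unfold smoothCone
    rw [div_le_iff₀ (by positivity)]
    nlinarith
  have := smoothCone_nonneg hA hε z
  have := smoothCone_nonneg hA hε w
  have := hle z
  have := hle w
  exact abs_sub_le_iff.2 ⟨by linarith, by linarith⟩

end SmoothCone

/-- A smooth function which vanishes at the origin and tends to `1` at infinity. -/
noncomputable def farPenalty {n : ℕ} (η : ℝ) (x : EuclideanSpace ℝ (Fin n)) : ℝ :=
  1 - 1 / (1 + (η * ‖x‖) ^ 2)

section FarPenalty

variable {n : ℕ} {η : ℝ}

theorem contDiff_farPenalty :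
    ContDiff ℝ 2 (farPenalty η : EuclideanSpace ℝ (Fin n) → ℝ) := by
  unfold farPenalty
  refine contDiff_const.sub (contDiff_const.div ?_ fun x => by positivity)
  simp only [mul_pow]
  exact contDiff_const.add (contDiff_const.mul (contDiff_norm_sq ℝ))

theorem farPenalty_nonneg (x : EuclideanSpace ℝ (Fin n)) : 0 ≤ farPenalty η x := by
  unfold farPenalty
  rw [sub_nonneg, div_le_one (by positivity)]
  nlinarith [sq_nonneg (η * ‖x‖)]

theorem half_le_farPenalty (hη : 0 < η) {x : EuclideanSpace ℝ (Fin n)} (hx : η⁻¹ ≤ ‖x‖) :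
    1 / 2 ≤ farPenalty η x := by
  have h : 1 ≤ η * ‖x‖ := by
    rwa [inv_eq_one_div, div_le_iff₀' hη] at hx
  have : 1 / (1 + (η * ‖x‖) ^ 2) ≤ 1 / 2 := by
    apply one_div_le_one_div_of_le two_pos
    nlinarith
  unfold farPenalty
  linarith

theorem abs_farPenalty_sub_le (hη : 0 < η) (x y : EuclideanSpace ℝ (Fin n)) :
    |farPenalty η x - farPenalty η y| ≤ min (η * ‖x - y‖) 1 := by
  have hlt : ∀ x : EuclideanSpace ℝ (Fin n), farPenalty η x ≤ 1 := fun x => by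
    unfold farPenalty
    have : 0 ≤ 1 / (1 + (η * ‖x‖) ^ 2) := by positivity
    linarith
  refine le_min ?_ ?_
  · have h1 : |η * ‖x‖ - η * ‖y‖| ≤ η * ‖x - y‖ := by
      rw [← mul_sub, abs_mul, abs_of_pos hη]
      exact mul_le_mul_of_nonneg_left (abs_norm_sub_norm_le x y) hη.le
    refine le_trans ?_ h1
    have ha : 0 ≤ η * ‖x‖ := by positivity
    have hb : 0 ≤ η * ‖y‖ := by positivity
    unfold farPenalty
    set a := η * ‖x‖
    set b := η * ‖y‖
    have : 1 - 1 / (1 + a ^ 2) - (1 - 1 / (1 + b ^ 2))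
        = (a - b) * ((a + b) / ((1 + a ^ 2) * (1 + b ^ 2))) := by
      field_simp
      ring
    rw [this, abs_mul, abs_of_nonneg (by positivity : 0 ≤ (a + b) / ((1 + a ^ 2) * (1 + b ^ 2)))]
    refine mul_le_of_le_one_right (abs_nonneg _) ((div_le_one (by positivity)).2 ?_)
    nlinarith [sq_nonneg (a - 1), sq_nonneg (b - 1), mul_nonneg (sq_nonneg a) (sq_nonneg b)]
  · have := farPenalty_nonneg (η := η) x
    have := farPenalty_nonneg (η := η) y
    have := hlt x
    have := hlt y
    exact abs_sub_le_iff.2 ⟨by linarith, by linarith⟩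

theorem tendsto_farPenalty (x : EuclideanSpace ℝ (Fin n)) :
    Tendsto (fun η => farPenalty η x) (𝓝[>] 0) (𝓝 0) := by
  have : Continuous (fun η => farPenalty η x) := by
    unfold farPenalty
    exact continuous_const.sub (continuous_const.div (by fun_prop) fun η => by positivity)
  have h := this.tendsto 0
  have h0 : farPenalty 0 x = 0 := by simp [farPenalty]
  rw [h0] at h
  exact h.mono_left nhdsWithin_le_nhds

end FarPenalty

/-- A smooth regularisation of `2 σ⁺` with derivative at least `1` on `[0, ∞)`. -/
noncomputable def timeModulus (ε σ : ℝ) : ℝ := σ + smoothAbs ε σ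

section TimeModulus

variable {ε : ℝ}

theorem contDiff_timeModulus (hε : 0 < ε) : ContDiff ℝ 2 (timeModulus ε) :=
  contDiff_id.add (contDiff_smoothAbs hε)

theorem hasDerivAt_timeModulus (hε : 0 < ε) (σ : ℝ) :
    HasDerivAt (timeModulus ε) (1 + σ / smoothAbs ε σ) σ :=
  (hasDerivAt_id σ).add (hasDerivAt_smoothAbs hε σ)

theorem timeModulus_nonneg (σ : ℝ) : 0 ≤ timeModulus ε σ := by
  have := abs_le_smoothAbs ε σ
  have := neg_abs_le σ
  unfold timeModulus
  linarith

theorem timeModulus_le (hε : 0 < ε) (σ : ℝ) : timeModulus ε σ ≤ 2 * max σ 0 + ε := by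
  have h := smoothAbs_le hε σ
  unfold timeModulus
  rcases le_total 0 σ with h0 | h0
  · rw [abs_of_nonneg h0] at h
    rw [max_eq_left h0]; linarith
  · rw [abs_of_nonpos h0] at h
    rw [max_eq_right h0]; linarith

end TimeModulus

/-! ### Viscosity inequalities with separated test functions -/

/-- The increment `w(x) - w(x+y)`, where `w` is `p` near `x` and `v` away from it. -/
noncomputable def gluedDiff {n : ℕ} (p v : EuclideanSpace ℝ (Fin n) → ℝ) (r : ℝ)
    (x y : EuclideanSpace ℝ (Fin n)) : ℝ :=
  if ‖y‖ < r then p x - p (x + y) else v x - v (x + y)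

section Viscosity

variable {n : ℕ} {s lam Lam T : ℝ} {K φ : EuclideanSpace ℝ (Fin n) → ℝ}
  {u : EuclideanSpace ℝ (Fin n) → ℝ → ℝ}

/-- The normalisation makes the test function equal `u x t` at the touching point, so the glued
function has the same base value in the near and far increments. -/
theorem obstacleOp_add {x : EuclideanSpace ℝ (Fin n)} {t r : ℝ} (hr : 0 < r)
    {p : EuclideanSpace ℝ (Fin n) → ℝ} {q : ℝ → ℝ} {q' : ℝ} (hq' : HasDerivAt q q' t) :
    obstacleOp K φ u (fun z => u x t + (p z.1 - p x) + (q z.2 - q t)) x t r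
      = min (q' + ∫ y, gluedDiff p (fun z => u z t) r x y * K y) (u x t - φ x) := by
  have hd : deriv (fun τ => u x t + (p x - p x) + (q τ - q t)) t = q' :=
    ((hq'.sub_const (q t)).const_add (u x t + (p x - p x))).deriv
  unfold obstacleOp nonlocalOp
  rw [hd]
  congr 3
  ext y
  congr 1
  by_cases hy : ‖y‖ < r
  · simp [glue, gluedDiff, hr, hy]
  · simp [glue, gluedDiff, hr, hy]

theorem IsViscositySubsolution.le_of_touching (hu : IsViscositySubsolution K φ T u)
    {x : EuclideanSpace ℝ (Fin n)} {t r : ℝ} (hr : 0 < r) (hr0 : 0 ≤ t - r) (hrT : t + r ≤ T)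
    {p : EuclideanSpace ℝ (Fin n) → ℝ} {q : ℝ → ℝ} {q' : ℝ} (hp : ContDiff ℝ 2 p)
    (hq : ContDiff ℝ 2 q) (hq' : HasDerivAt q q' t)
    (htouch : ∀ y, ∀ τ ∈ Ico 0 T, u y τ ≤ u x t + (p y - p x) + (q τ - q t)) :
    q' + ∫ y, gluedDiff p (fun z => u z t) r x y * K y ≤ 0 ∨ u x t ≤ φ x := by
  have h := hu x t r (fun z => u x t + (p z.1 - p x) + (q z.2 - q t)) hr hr0 hrT
    (by fun_prop)
    (fun y _ τ hτ => htouch y τ ⟨hr0.trans hτ.1.le, hτ.2.trans_le hrT⟩) (by simp)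
  rw [obstacleOp_add hr hq', min_le_iff, sub_nonpos] at h
  exact h

theorem IsViscositySupersolution.le_of_touching (hu : IsViscositySupersolution K φ T u)
    {x : EuclideanSpace ℝ (Fin n)} {t r : ℝ} (hr : 0 < r) (hr0 : 0 ≤ t - r) (hrT : t + r ≤ T)
    {p : EuclideanSpace ℝ (Fin n) → ℝ} {q : ℝ → ℝ} {q' : ℝ} (hp : ContDiff ℝ 2 p)
    (hq : ContDiff ℝ 2 q) (hq' : HasDerivAt q q' t)
    (htouch : ∀ y, ∀ τ ∈ Ico 0 T, u x t + (p y - p x) + (q τ - q t) ≤ u y τ) :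
    0 ≤ q' + ∫ y, gluedDiff p (fun z => u z t) r x y * K y ∧ φ x ≤ u x t := by
  have h := hu x t r (fun z => u x t + (p z.1 - p x) + (q z.2 - q t)) hr hr0 hrT
    (by fun_prop)
    (fun y _ τ hτ => htouch y τ ⟨hr0.trans hτ.1.le, hτ.2.trans_le hrT⟩) (by simp)
  rw [obstacleOp_add hr hq', le_min_iff, sub_nonneg] at h
  exact h

/-- Bochner integrals of non-integrable functions are zero by convention, so integrability is needed
before the viscosity inequalities can be subtracted or estimated. -/
theorem integrable_gluedDiff_mul (hn : 1 ≤ n) (hs : s ∈ Ioo (0 : ℝ) (1 / 2))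
    (hK : IsEllipticKernel n s lam Lam K) (hlam : 0 < lam)
    {p v : EuclideanSpace ℝ (Fin n) → ℝ} {r c M : ℝ} (hr : 0 < r) (hr1 : r ≤ 1)
    (hp : Continuous p) (hv : Continuous v) (hc : ∀ a b, |p a - p b| ≤ c * ‖a - b‖)
    (hM : ∀ a, |v a| ≤ M) (x : EuclideanSpace ℝ (Fin n)) :
    Integrable (fun y => gluedDiff p v r x y * K y) := by
  have hM0 : 0 ≤ M := (abs_nonneg _).trans (hM 0)
  have hmeas : Measurable (gluedDiff p v r x) :=
    Measurable.ite (measurableSet_lt measurable_norm measurable_const)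
      (by fun_prop : Continuous fun y => p x - p (x + y)).measurable
      (by fun_prop : Continuous fun y => v x - v (x + y)).measurable
  -- The Lipschitz bound serves inside the ball. Outside, the increment is at most `2 * M = (2 * M /
  -- r) * r`, and `r ≤ min ‖y‖ 2`.
  refine hK.integrable_mul hn hs hlam hmeas (c := |c| + 2 * M / r) fun y => ?_
  unfold gluedDiff
  split_ifs with hy
  · have hmin : min ‖y‖ 2 = ‖y‖ := min_eq_left (by linarith)
    have h := hc x (x + y)
    rw [sub_add_cancel_left, norm_neg] at h
    rw [hmin]
    refine h.trans (mul_le_mul_of_nonneg_right ?_ (norm_nonneg y))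
    have := le_abs_self c
    have : 0 ≤ 2 * M / r := by positivity
    linarith
  · have hmin : r ≤ min ‖y‖ 2 := le_min (not_lt.1 hy) (by linarith)
    calc |v x - v (x + y)| ≤ |v x| + |v (x + y)| := abs_sub _ _
      _ ≤ 2 * M := by linarith [hM x, hM (x + y)]
      _ = 2 * M / r * r := by field_simp
      _ ≤ (|c| + 2 * M / r) * min ‖y‖ 2 := by
        refine mul_le_mul ?_ hmin hr.le (by positivity)
        have := abs_nonneg c
        linarith

end Viscosity

/-! ### Doubling of variables -/

/-- Existence of a maximum point of the doubled function, for nonnegative penalties that are large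
outside of a compact set. -/
theorem exists_doubled_max {n : ℕ} {T T₂ ρ M : ℝ} {u : EuclideanSpace ℝ (Fin n) → ℝ → ℝ}
    (hu : ContinuousOn (fun p : EuclideanSpace ℝ (Fin n) × ℝ => u p.1 p.2) (univ ×ˢ Ico 0 T))
    (hM : ∀ x, ∀ t ∈ Ico 0 T, |u x t| ≤ M)
    {N f : EuclideanSpace ℝ (Fin n) → ℝ} {m g : ℝ → ℝ} (hN : Continuous N) (hf : Continuous f)
    (hm : Continuous m) (hg : Continuous g) (hN0 : ∀ x, 0 ≤ N x) (hf0 : ∀ x, 0 ≤ f x)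
    (hm0 : ∀ t, 0 ≤ m t) (hg0 : ∀ t, 0 ≤ g t) (hT₂ : T₂ < T)
    (hfar : ∀ x, ρ ≤ ‖x‖ → 2 * M ≤ f x) (hlate : ∀ t, T₂ ≤ t → 2 * M ≤ g t)
    {x₀ y₀ : EuclideanSpace ℝ (Fin n)} {t₀ τ₀ : ℝ} (ht₀ : t₀ ∈ Ico 0 T) (hτ₀ : τ₀ ∈ Ico 0 T)
    (hpos : N (x₀ - y₀) + m (t₀ - τ₀) + f x₀ + f y₀ + g t₀ + g τ₀ < u x₀ t₀ - u y₀ τ₀) :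
    ∃ x y, ∃ t ∈ Ico 0 T, ∃ τ ∈ Ico 0 T,
      N (x - y) + m (t - τ) + f x + f y + g t + g τ < u x t - u y τ ∧
      ∀ x' y', ∀ t' ∈ Ico 0 T, ∀ τ' ∈ Ico 0 T,
        u x' t' - u y' τ' - (N (x' - y') + m (t' - τ') + f x' + f y' + g t' + g τ') ≤
          u x t - u y τ - (N (x - y) + m (t - τ) + f x + f y + g t + g τ) := by
  set F : (EuclideanSpace ℝ (Fin n) × ℝ) × (EuclideanSpace ℝ (Fin n) × ℝ) → ℝ := fun q =>
    u q.1.1 q.1.2 - u q.2.1 q.2.2 - (N (q.1.1 - q.2.1) + m (q.1.2 - q.2.2) + f q.1.1 + f q.2.1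
      + g q.1.2 + g q.2.2) with hF
  set Q : Set (EuclideanSpace ℝ (Fin n) × ℝ) := closedBall 0 ρ ×ˢ Icc 0 T₂ with hQ
  have hQc : IsCompact (Q ×ˢ Q) :=
    ((isCompact_closedBall 0 ρ).prod isCompact_Icc).prod
      ((isCompact_closedBall 0 ρ).prod isCompact_Icc)
  have hQs : Q ⊆ univ ×ˢ Ico 0 T := fun q hq => ⟨mem_univ _, hq.2.1, hq.2.2.trans_lt hT₂⟩
  have hFc : ContinuousOn F (Q ×ˢ Q) := by
    refine ContinuousOn.sub (ContinuousOn.sub ?_ ?_) (Continuous.continuousOn (by fun_prop))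
    · exact hu.comp continuous_fst.continuousOn fun q hq => hQs hq.1
    · exact hu.comp continuous_snd.continuousOn fun q hq => hQs hq.2
  -- a point with positive value lies in the compact set
  have hmem : ∀ x y, ∀ t ∈ Ico 0 T, ∀ τ ∈ Ico 0 T, 0 < F ((x, t), (y, τ)) →
      ((x, t), (y, τ)) ∈ Q ×ˢ Q := by
    intro x y t ht τ hτ hlt
    simp only [hF] at hlt
    have h1 := (abs_le.1 (hM x t ht)).2
    have h2 := (abs_le.1 (hM y τ hτ)).1
    have := hN0 (x - y)
    have := hm0 (t - τ)
    have := hf0 x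
    have := hf0 y
    have := hg0 t
    have := hg0 τ
    refine ⟨⟨?_, ht.1, ?_⟩, ?_, hτ.1, ?_⟩
    · rw [mem_closedBall_zero_iff]
      by_contra! hc
      linarith [hfar x hc.le]
    · by_contra! hc
      linarith [hlate t hc.le]
    · rw [mem_closedBall_zero_iff]
      by_contra! hc
      linarith [hfar y hc.le]
    · by_contra! hc
      linarith [hlate τ hc.le]
  have hF₀ : 0 < F ((x₀, t₀), (y₀, τ₀)) := by simp only [hF]; linarith
  have hQ₀ := hmem x₀ y₀ t₀ ht₀ τ₀ hτ₀ hF₀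
  obtain ⟨⟨⟨x, t⟩, ⟨y, τ⟩⟩, hq, hmax⟩ := hQc.exists_isMaxOn ⟨_, hQ₀⟩ hFc
  have hFq : 0 < F ((x, t), (y, τ)) := hF₀.trans_le (hmax hQ₀)
  refine ⟨x, y, t, (hQs hq.1).2, τ, (hQs hq.2).2, ?_, ?_⟩
  · simp only [hF] at hFq; linarith
  · intro x' y' t' ht' τ' hτ'
    change F ((x', t'), (y', τ')) ≤ F ((x, t), (y, τ))
    by_cases hc : 0 < F ((x', t'), (y', τ'))
    · exact hmax (hmem x' y' t' ht' τ' hτ' hc)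
    · exact (not_lt.1 hc).trans hFq.le

section Doubling

variable {n : ℕ} {s lam Lam T : ℝ} {K φ : EuclideanSpace ℝ (Fin n) → ℝ}
  {u : EuclideanSpace ℝ (Fin n) → ℝ → ℝ}

/-- The first moment of the weight `|y|^(-n-2s)`, truncated at infinity. -/
noncomputable def truncatedMoment (n : ℕ) (s : ℝ) : ℝ :=
  ∫ y : EuclideanSpace ℝ (Fin n), min ‖y‖ 2 * fracWeight n s y

theorem truncatedMoment_nonneg (n : ℕ) (s : ℝ) : 0 ≤ truncatedMoment n s :=
  integral_nonneg fun y =>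
    mul_nonneg (le_min (norm_nonneg y) zero_le_two) (fracWeight_nonneg n s y)

theorem min_mul_norm_le {η : ℝ} (hη1 : η ≤ 1) (y : EuclideanSpace ℝ (Fin n)) :
    min (η * ‖y‖) 1 ≤ min ‖y‖ 2 :=
  min_le_min (mul_le_of_le_one_left (norm_nonneg y) hη1) one_le_two

theorem tendsto_integral_min_mul_norm (hn : 1 ≤ n) (hs : s ∈ Ioo (0 : ℝ) (1 / 2)) :
    Tendsto (fun η => ∫ y : EuclideanSpace ℝ (Fin n), min (η * ‖y‖) 1 * fracWeight n s y)
      (𝓝[>] 0) (𝓝 0) := by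
  refine tendsto_integral_mul_fracWeight hn hs (h := fun η y => min (η * ‖y‖) 1)
    (fun r => by fun_prop) (fun r hr y => by positivity) (fun r _ hr1 y => min_mul_norm_le hr1 y)
    fun y _ => ?_
  have h : Continuous fun η : ℝ => min (η * ‖y‖) 1 := by fun_prop
  have := h.tendsto 0
  simp only [zero_mul, min_eq_left zero_le_one] at this
  exact this.mono_left nhdsWithin_le_nhds

theorem ite_norm_lt_le {r : ℝ} (hr1 : r ≤ 1) (y : EuclideanSpace ℝ (Fin n)) :
    (if ‖y‖ < r then ‖y‖ else 0) ≤ min ‖y‖ 2 := by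
  split_ifs with hy
  · exact le_min le_rfl (by linarith)
  · exact le_min (norm_nonneg y) zero_le_two

theorem measurable_ite_norm_lt (r : ℝ) :
    Measurable fun y : EuclideanSpace ℝ (Fin n) => if ‖y‖ < r then ‖y‖ else 0 :=
  Measurable.ite (measurableSet_lt measurable_norm measurable_const) measurable_norm
    measurable_const

theorem tendsto_integral_ite_norm_lt (hn : 1 ≤ n) (hs : s ∈ Ioo (0 : ℝ) (1 / 2)) :
    Tendsto (fun r => ∫ y : EuclideanSpace ℝ (Fin n),
      (if ‖y‖ < r then ‖y‖ else 0) * fracWeight n s y) (𝓝[>] 0) (𝓝 0) := by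
  refine tendsto_integral_mul_fracWeight hn hs (h := fun r y => if ‖y‖ < r then ‖y‖ else 0)
    measurable_ite_norm_lt (fun r hr y => by positivity)
    (fun r _ hr1 y => ite_norm_lt_le hr1 y) fun y hy => ?_
  refine tendsto_const_nhds.congr' ?_
  filter_upwards [Ioo_mem_nhdsGT (norm_pos_iff.2 hy)] with r hr
  rw [if_neg (not_lt.2 hr.2.le)]

/-- `∫ D K ≤ Λ (a ∫ h₁ |y|^(-n-2s) + b ∫ h₂ |y|^(-n-2s))` if `D ≤ a h₁ + b h₂`. -/
theorem IsEllipticKernel.integral_mul_le_add (hn : 1 ≤ n) (hs : s ∈ Ioo (0 : ℝ) (1 / 2))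
    (hK : IsEllipticKernel n s lam Lam K) (hlam : 0 < lam)
    {D h₁ h₂ : EuclideanSpace ℝ (Fin n) → ℝ} {a b : ℝ} (ha : 0 ≤ a) (hb : 0 ≤ b)
    (hD : Integrable (fun y => D y * K y)) (hm₁ : Measurable h₁) (hm₂ : Measurable h₂)
    (h₁0 : ∀ y, 0 ≤ h₁ y) (h₂0 : ∀ y, 0 ≤ h₂ y) (h₁le : ∀ y, h₁ y ≤ min ‖y‖ 2)
    (h₂le : ∀ y, h₂ y ≤ min ‖y‖ 2) (hle : ∀ y, D y ≤ a * h₁ y + b * h₂ y) :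
    ∫ y, D y * K y ≤
      Lam * (a * (∫ y, h₁ y * fracWeight n s y) + b * ∫ y, h₂ y * fracWeight n s y) := by
  have i₁ := integrable_mul_fracWeight hn hs hm₁ h₁0 (c := 1) (by simpa using h₁le)
  have i₂ := integrable_mul_fracWeight hn hs hm₂ h₂0 (c := 1) (by simpa using h₂le)
  have heq : ∀ y, (a * h₁ y + b * h₂ y) * fracWeight n s y
      = a * (h₁ y * fracWeight n s y) + b * (h₂ y * fracWeight n s y) := fun y => by ring
  have h := hK.integral_mul_le hn hlam hD (h := fun y => a * h₁ y + b * h₂ y)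
    (by simp only [heq]; exact (i₁.const_mul a).add (i₂.const_mul b))
    (fun y => add_nonneg (mul_nonneg ha (h₁0 y)) (mul_nonneg hb (h₂0 y))) hle
  simp only [heq] at h
  rwa [integral_add (i₁.const_mul a) (i₂.const_mul b), integral_const_mul,
    integral_const_mul] at h

/-- The modulus of continuity obtained by doubling the variables. -/
theorem IsViscositySolution.sub_le_smoothCone_add (hn : 1 ≤ n) (hs : s ∈ Ioo (0 : ℝ) (1 / 2))
    (hK : IsEllipticKernel n s lam Lam K) (hlam : 0 < lam) (hLam : lam ≤ Lam)
    (hu : IsViscositySolution K φ T u) {S P : ℝ} (hS : ∀ x, |φ x| ≤ S) (hP0 : 0 ≤ P)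
    (hP : ∀ x y, φ x - φ y ≤ P * ‖x - y‖) {ε : ℝ} (hε : 0 < ε)
    (x₀ y₀ : EuclideanSpace ℝ (Fin n)) {t₀ τ₀ : ℝ} (ht₀ : t₀ ∈ Ico 0 T) (hτ₀ : τ₀ ∈ Ico 0 T) :
    u x₀ t₀ - u y₀ τ₀ ≤ smoothCone (S + P) ε (x₀ - y₀) +
      Lam * ((S + P) * truncatedMoment n s) * timeModulus ε (t₀ - τ₀) := by
  by_contra! hlt
  obtain ⟨M, hM⟩ := hu.bounded
  have hM0 : 0 ≤ M := (abs_nonneg _).trans (hM x₀ t₀ ht₀)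
  have hS0 : 0 ≤ S := (abs_nonneg _).trans (hS x₀)
  have hLam0 : 0 < Lam := hlam.trans_le hLam
  set A := S + P with hA
  have hA0 : 0 ≤ A := add_nonneg hS0 hP0
  set J := truncatedMoment n s with hJ
  have hJ0 : 0 ≤ J := truncatedMoment_nonneg n s
  set C := Lam * (A * J) with hC
  have hC0 : 0 ≤ C := by positivity
  set N : EuclideanSpace ℝ (Fin n) → ℝ := smoothCone A ε with hN
  set m : ℝ → ℝ := fun σ => C * timeModulus ε σ with hm
  -- The gap `γ` is shared among the four penalty values at the reference points, each kept below `γ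
  -- / 4`.
  obtain ⟨γ, hγ, hlt⟩ : ∃ γ, 0 < γ ∧ N (x₀ - y₀) + m (t₀ - τ₀) + γ = u x₀ t₀ - u y₀ τ₀ :=
    ⟨_, sub_pos.2 hlt, by ring⟩
  obtain ⟨T₂, hT₂, hT₂T⟩ := exists_between (max_lt ht₀.2 hτ₀.2)
  have ht₀T₂ : t₀ < T₂ := (le_max_left _ _).trans_lt hT₂
  have hτ₀T₂ : τ₀ < T₂ := (le_max_right _ _).trans_lt hT₂
  -- the time penalty
  obtain ⟨G, hG0, hGM⟩ : ∃ G : ℝ, 0 < G ∧ 2 * M ≤ G := ⟨2 * M + 1, by positivity, by linarith⟩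
  have hexp : ∀ σ, σ < T₂ → Tendsto (fun k : ℝ => G * Real.exp (k * (σ - T₂))) atTop (𝓝 0) := by
    intro σ hσ
    have h := Real.tendsto_exp_atBot.comp
      (tendsto_id.atTop_mul_const_of_neg (sub_neg.2 hσ))
    simpa using h.const_mul G
  have hγ4 : 0 < γ / 4 := by positivity
  obtain ⟨k, hkt, hkτ, hk0⟩ := ((hexp t₀ ht₀T₂).eventually (gt_mem_nhds hγ4)).and
    (((hexp τ₀ hτ₀T₂).eventually (gt_mem_nhds hγ4)).and (eventually_gt_atTop 0)) |>.exists
  set g : ℝ → ℝ := fun σ => G * Real.exp (k * (σ - T₂)) with hg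
  set g' : ℝ → ℝ := fun σ => G * (Real.exp (k * (σ - T₂)) * k) with hg'
  have hgd : ∀ σ, HasDerivAt g (g' σ) σ := fun σ => by
    have h : HasDerivAt (fun σ : ℝ => k * (σ - T₂)) k σ := by
      simpa using ((hasDerivAt_id σ).sub_const T₂).const_mul k
    exact h.exp.const_mul G
  have hgC : ContDiff ℝ 2 g := by fun_prop
  -- The slack `δ` is fixed before `η` and `r`, so the errors from the space penalty and the small
  -- ball can both be made smaller than it.
  set δ := g' 0 with hδ
  have hδ0 : 0 < δ := by simp only [hδ, hg']; positivity
  have hgδ : ∀ σ, 0 ≤ σ → δ ≤ g' σ := fun σ hσ => by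
    simp only [hδ, hg']
    gcongr
  -- the space penalty
  obtain ⟨B, hB0, hBM⟩ : ∃ B : ℝ, 0 < B ∧ 2 * M ≤ B * (1 / 2) :=
    ⟨4 * M + 1, by positivity, by linarith⟩
  have hH : Tendsto (fun η => Lam * ((2 * B) * ∫ y : EuclideanSpace ℝ (Fin n),
      min (η * ‖y‖) 1 * fracWeight n s y)) (𝓝[>] 0) (𝓝 0) := by
    simpa using ((tendsto_integral_min_mul_norm hn hs).const_mul (2 * B)).const_mul Lam
  have hfx : ∀ x : EuclideanSpace ℝ (Fin n),
      Tendsto (fun η => B * farPenalty η x) (𝓝[>] 0) (𝓝 0) := fun x => by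
    simpa using (tendsto_farPenalty x).const_mul B
  obtain ⟨η, hηH, hηx, hηy, hη0, hη1⟩ := (hH.eventually (gt_mem_nhds hδ0)).and
    (((hfx x₀).eventually (gt_mem_nhds hγ4)).and (((hfx y₀).eventually (gt_mem_nhds hγ4)).and
      (Ioc_mem_nhdsGT zero_lt_one))) |>.exists
  set H := ∫ y : EuclideanSpace ℝ (Fin n), min (η * ‖y‖) 1 * fracWeight n s y with hHdef
  have hH0 : 0 ≤ H := integral_nonneg fun y =>
    mul_nonneg (by positivity) (fracWeight_nonneg n s y)
  set f : EuclideanSpace ℝ (Fin n) → ℝ := fun x => B * farPenalty η x with hf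
  have hfC : ContDiff ℝ 2 f := contDiff_const.mul contDiff_farPenalty
  have hf0 : ∀ x, 0 ≤ f x := fun x => mul_nonneg hB0.le (farPenalty_nonneg x)
  have hfd : ∀ a b, |f a - f b| ≤ B * min (η * ‖a - b‖) 1 := fun a b => by
    simp only [hf]
    rw [← mul_sub, abs_mul, abs_of_pos hB0]
    exact mul_le_mul_of_nonneg_left (abs_farPenalty_sub_le hη0 a b) hB0.le
  have hNC : ContDiff ℝ 2 N := contDiff_smoothCone hε
  have hNd : ∀ a b, |N a - N b| ≤ A * min ‖a - b‖ 2 := fun a b => abs_smoothCone_sub_le hA0 hε a b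
  have hmC : ContDiff ℝ 2 m := contDiff_const.mul (contDiff_timeModulus hε)
  have hm0 : ∀ σ, 0 ≤ m σ := fun σ => mul_nonneg hC0 (timeModulus_nonneg σ)
  have hN0 : ∀ z, 0 ≤ N z := smoothCone_nonneg hA0 hε
  have hg0 : ∀ σ, 0 ≤ g σ := fun σ => by positivity
  obtain ⟨x, y, t, ht, τ, hτ, hpos, hmax⟩ := exists_doubled_max hu.continuousOn hM
    hNC.continuous hfC.continuous hmC.continuous hgC.continuous hN0 hf0 hm0 hg0 hT₂T
    (ρ := η⁻¹)
    (fun x hx => hBM.trans (mul_le_mul_of_nonneg_left (half_le_farPenalty hη0 hx) hB0.le))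
    (fun σ hσ => hGM.trans (le_mul_of_one_le_right hG0.le
      (Real.one_le_exp (mul_nonneg hk0.le (sub_nonneg.2 hσ)))))
    ht₀ hτ₀ (x₀ := x₀) (y₀ := y₀) (by simp only [hf, hg]; linarith)
  -- the test functions
  set p₁ : EuclideanSpace ℝ (Fin n) → ℝ := fun z => N (z - y) + f z with hp₁
  -- Freezing the first point at the maximum turns the penalties into a test function from below for
  -- the second, hence the signs.
  set p₂ : EuclideanSpace ℝ (Fin n) → ℝ := fun z => -N (x - z) - f z with hp₂
  set m' := C * (1 + (t - τ) / smoothAbs ε (t - τ)) with hm'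
  have hmd : HasDerivAt m m' (t - τ) := (hasDerivAt_timeModulus hε _).const_mul C
  have hp₁C : ContDiff ℝ 2 p₁ := by fun_prop
  have hp₂C : ContDiff ℝ 2 p₂ := by fun_prop
  have hq₁C : ContDiff ℝ 2 (fun σ => m (σ - τ) + g σ) := by fun_prop
  have hq₂C : ContDiff ℝ 2 (fun σ => -m (t - σ) - g σ) := by fun_prop
  have hq₁d : HasDerivAt (fun σ => m (σ - τ) + g σ) (m' + g' t) t :=
    (hmd.comp_sub_const t τ).add (hgd t)
  have hq₂d : HasDerivAt (fun σ => -m (t - σ) - g σ) (m' - g' τ) τ := by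
    have h := (hmd.comp_const_sub t τ).neg.sub (hgd τ)
    rwa [neg_neg] at h
  have hsub : ∀ r, 0 < r → 0 ≤ t - r → t + r ≤ T →
      m' + g' t + ∫ z, gluedDiff p₁ (fun z => u z t) r x z * K z ≤ 0 ∨ u x t ≤ φ x := by
    intro r hr hr0 hrT
    refine hu.sub.le_of_touching hr hr0 hrT hp₁C hq₁C hq₁d fun z σ hσ => ?_
    have := hmax z y σ hσ τ hτ
    simp only [hp₁]
    linarith
  have hsuper : ∀ r, 0 < r → 0 ≤ τ - r → τ + r ≤ T →
      0 ≤ m' - g' τ + ∫ z, gluedDiff p₂ (fun z => u z τ) r y z * K z ∧ φ y ≤ u y τ := by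
    intro r hr hr0 hrT
    refine hu.super.le_of_touching hr hr0 hrT hp₂C hq₂C hq₂d fun z σ hσ => ?_
    have := hmax x z t ht σ hσ
    simp only [hp₂]
    linarith
  -- the solution does not touch the obstacle at the maximum point
  have hφy : φ y ≤ u y τ := by
    rcases hτ.1.eq_or_lt with h0 | h0
    · rw [← h0, hu.initial]
    · have hr : 0 < min τ (T - τ) := lt_min h0 (sub_pos.2 hτ.2)
      exact (hsuper _ hr (sub_nonneg.2 (min_le_left _ _))
        (by linarith [min_le_right τ (T - τ)])).2
  have hφx : ¬ u x t ≤ φ x := fun hle => by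
    have h1 : φ x - φ y ≤ N (x - y) :=
      le_smoothCone hε hP0 (by linarith [(abs_le.1 (hS x)).2, (abs_le.1 (hS y)).1]) (hP x y)
    linarith [hm0 (t - τ), hf0 x, hf0 y, hg0 t, hg0 τ]
  have ht0 : 0 < t := by
    refine ht.1.lt_of_ne fun h0 => hφx ?_
    rw [← h0, hu.initial]
  have hucont : ∀ σ ∈ Ico 0 T, Continuous fun z => u z σ := fun σ hσ => by
    rw [← continuousOn_univ]
    exact hu.continuousOn.comp (f := fun z => (z, σ)) (by fun_prop) fun z _ => ⟨mem_univ _, hσ⟩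
  have hp₁d : ∀ a b, |p₁ a - p₁ b| ≤ A * min ‖a - b‖ 2 + B * min (η * ‖a - b‖) 1 := fun a b => by
    have h1 := hNd (a - y) (b - y)
    rw [sub_sub_sub_cancel_right] at h1
    simp only [hp₁]
    rw [add_sub_add_comm]
    exact (abs_add_le _ _).trans (add_le_add h1 (hfd a b))
  have hp₂d : ∀ a b, |p₂ a - p₂ b| ≤ A * min ‖a - b‖ 2 + B * min (η * ‖a - b‖) 1 := fun a b => by
    have h1 := hNd (x - b) (x - a)
    rw [sub_sub_sub_cancel_left] at h1
    have h2 := hfd b a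
    rw [norm_sub_rev] at h2
    have : p₂ a - p₂ b = (N (x - b) - N (x - a)) + (f b - f a) := by simp only [hp₂]; ring
    rw [this]
    exact (abs_add_le _ _).trans (add_le_add h1 h2)
  have hlip : ∀ a b : EuclideanSpace ℝ (Fin n),
      A * min ‖a - b‖ 2 + B * min (η * ‖a - b‖) 1 ≤ (A + B * η) * ‖a - b‖ := fun a b => by
    have h1 := mul_le_mul_of_nonneg_left (min_le_left ‖a - b‖ 2) hA0
    have h2 := mul_le_mul_of_nonneg_left (min_le_left (η * ‖a - b‖) 1) hB0.le
    linarith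
  have hint₁ : ∀ r, 0 < r → r ≤ 1 →
      Integrable (fun z => gluedDiff p₁ (fun z => u z t) r x z * K z) := fun r hr hr1 =>
    integrable_gluedDiff_mul hn hs hK hlam hr hr1 hp₁C.continuous (hucont t ht)
      (fun a b => (hp₁d a b).trans (hlip a b)) (fun a => hM a t ht) x
  have hint₂ : ∀ r, 0 < r → r ≤ 1 →
      Integrable (fun z => gluedDiff p₂ (fun z => u z τ) r y z * K z) := fun r hr hr1 =>
    integrable_gluedDiff_mul hn hs hK hlam hr hr1 hp₂C.continuous (hucont τ hτ)
      (fun a b => (hp₂d a b).trans (hlip a b)) (fun a => hM a τ hτ) y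
  have hmη : Measurable fun z : EuclideanSpace ℝ (Fin n) => min (η * ‖z‖) 1 := by fun_prop
  rcases hτ.1.eq_or_lt with hτ0 | hτ0
  · -- the maximum point lies on the initial surface in the second variable
    obtain ⟨r, hr, hr1⟩ : ∃ r, 0 < r ∧ r ≤ min 1 (min t (T - t)) :=
      ⟨_, lt_min one_pos (lt_min ht0 (sub_pos.2 ht.2)), le_rfl⟩
    rw [le_min_iff, le_min_iff] at hr1
    have h1 := (hsub r hr (by linarith) (by linarith)).resolve_right hφx
    have hneg : Integrable (fun z => -gluedDiff p₁ (fun z => u z t) r x z * K z) := by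
      simp only [neg_mul]
      exact (hint₁ r hr hr1.1).neg
    have h2 := hK.integral_mul_le_add hn hs hlam hA0 hB0.le hneg
      (h₁ := fun z => min ‖z‖ 2) (h₂ := fun z => min (η * ‖z‖) 1) (by fun_prop) hmη
      (fun z => by positivity) (fun z => by positivity) (fun z => le_rfl)
      (min_mul_norm_le hη1) fun z => by
        have h3 := (abs_le.1 (hp₁d x (x + z))).1
        rw [sub_add_cancel_left, norm_neg] at h3
        have h4 := hmax (x + z) y t ht τ hτ
        -- The test function touches from above on the whole space, so even the far increments of
        -- `u` are bounded below by those of `p₁`.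
        have h5 : p₁ x - p₁ (x + z) ≤ gluedDiff p₁ (fun z => u z t) r x z := by
          unfold gluedDiff
          split_ifs
          · exact le_rfl
          · simp only [hp₁]; linarith
        linarith
    simp only [neg_mul, integral_neg] at h2
    change _ ≤ Lam * (A * J + B * H) at h2
    -- Here `t - τ = t > 0`, where `timeModulus` has slope at least one; `C` is exactly the bound on
    -- the cone's nonlocal contribution.
    have h3 : C ≤ m' := by
      refine le_mul_of_one_le_right hC0 (le_add_of_nonneg_right ?_)
      rw [← hτ0, sub_zero]
      exact div_nonneg ht0.le (smoothAbs_pos hε t).le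
    have h4 := hgδ t ht0.le
    have h5 : 0 ≤ Lam * (B * H) := by positivity
    linarith [mul_add Lam (A * J) (B * H), mul_assoc 2 B H]
  · -- the maximum point is interior
    have hQ : Tendsto (fun r => Lam * ((2 * A) * ∫ y : EuclideanSpace ℝ (Fin n),
        (if ‖y‖ < r then ‖y‖ else 0) * fracWeight n s y)) (𝓝[>] 0) (𝓝 0) := by
      simpa using ((tendsto_integral_ite_norm_lt hn hs).const_mul (2 * A)).const_mul Lam
    have hmin0 : 0 < min 1 (min (min t (T - t)) (min τ (T - τ))) :=
      lt_min one_pos (lt_min (lt_min ht0 (sub_pos.2 ht.2)) (lt_min hτ0 (sub_pos.2 hτ.2)))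
    obtain ⟨r, hrQ, hr, hr1⟩ := (hQ.eventually (gt_mem_nhds hδ0)).and
      (Ioc_mem_nhdsGT hmin0) |>.exists
    simp only [le_min_iff] at hr1
    obtain ⟨hr1, ⟨hrt, hrt'⟩, hrτ, hrτ'⟩ := hr1
    have h1 := (hsub r hr (by linarith) (by linarith)).resolve_right hφx
    have h2 := (hsuper r hr (by linarith) (by linarith)).1
    have hdiff : ∫ z, (gluedDiff p₂ (fun z => u z τ) r y z
          - gluedDiff p₁ (fun z => u z t) r x z) * K z
        = (∫ z, gluedDiff p₂ (fun z => u z τ) r y z * K z)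
          - ∫ z, gluedDiff p₁ (fun z => u z t) r x z * K z := by
      rw [← integral_sub (hint₂ r hr hr1) (hint₁ r hr hr1)]
      simp only [sub_mul]
    have h3 := hK.integral_mul_le_add hn hs hlam (a := 2 * A) (b := 2 * B) (by positivity)
      (by positivity)
      (D := fun z => gluedDiff p₂ (fun z => u z τ) r y z - gluedDiff p₁ (fun z => u z t) r x z)
      (by simp only [sub_mul]; exact (hint₂ r hr hr1).sub (hint₁ r hr hr1))
      (h₁ := fun z => if ‖z‖ < r then ‖z‖ else 0) (h₂ := fun z => min (η * ‖z‖) 1)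
      (measurable_ite_norm_lt r) hmη (fun z => by positivity) (fun z => by positivity)
      (ite_norm_lt_le hr1) (min_mul_norm_le hη1) fun z => by
        unfold gluedDiff
        split_ifs with hz
        · have h3 := (abs_le.1 (hp₁d x (x + z))).1
          have h4 := (abs_le.1 (hp₂d y (y + z))).2
          rw [sub_add_cancel_left, norm_neg] at h3 h4
          have h5 := mul_le_mul_of_nonneg_left (min_le_left ‖z‖ 2) hA0
          linarith
        · have h3 := (abs_le.1 (hfd x (x + z))).1
          have h4 := (abs_le.1 (hfd y (y + z))).1
          rw [sub_add_cancel_left, norm_neg] at h3 h4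
          -- The common shift leaves `N` and `m` unchanged, so only the increments of `f` remain.
          have h5 := hmax (x + z) (y + z) t ht τ hτ
          rw [add_sub_add_right_eq_sub] at h5
          linarith
    rw [hdiff] at h3
    -- Subtracting the viscosity inequalities cancels `m'`: the two time penalties contribute at
    -- least `2 * δ`, while the errors controlled by `hrQ` and `hηH` total less.
    have h4 := hgδ t ht0.le
    have h5 := hgδ τ hτ0.le
    rw [mul_add Lam] at h3
    linarith

end Doubling

/-! ### Lipschitz bounds and the conclusion -/

/-- The sup norm and the Lipschitz constant of `φ ∈ C^{0,1}_c` are finite, and their sum is the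
`C^{0,1}` norm. -/
theorem MemC01c.exists_bounds {n : ℕ} {φ : EuclideanSpace ℝ (Fin n) → ℝ} (hφ : MemC01c φ) :
    ∃ S P : ℝ≥0, c01Norm φ = ((S + P : ℝ≥0) : ℝ≥0∞) ∧ (∀ x, |φ x| ≤ S) ∧
      ∀ x y, φ x - φ y ≤ P * ‖x - y‖ := by
  obtain ⟨⟨M, hM⟩, hc⟩ := hφ
  obtain ⟨b, hb⟩ := hc.exists_bound_of_continuous hM.continuous
  have hS : (⨆ x, ‖φ x‖ₑ) ≠ ⊤ := by
    refine ne_top_of_le_ne_top (b := ENNReal.ofReal b) ENNReal.ofReal_ne_top (iSup_le fun x => ?_)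
    rw [← ofReal_norm]
    exact ENNReal.ofReal_le_ofReal (hb x)
  have hP : (⨆ x, ⨆ y, ‖φ x - φ y‖ₑ / ‖x - y‖ₑ) ≠ ⊤ := by
    refine ne_top_of_le_ne_top (b := (M : ℝ≥0∞)) ENNReal.coe_ne_top
      (iSup_le fun x => iSup_le fun y => ENNReal.div_le_of_le_mul ?_)
    rw [← edist_eq_enorm_sub, ← edist_eq_enorm_sub]
    exact hM x y
  refine ⟨(⨆ x, ‖φ x‖ₑ).toNNReal, (⨆ x, ⨆ y, ‖φ x - φ y‖ₑ / ‖x - y‖ₑ).toNNReal, ?_,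
    fun x => ?_, fun x y => ?_⟩
  · rw [ENNReal.coe_add, ENNReal.coe_toNNReal hS, ENNReal.coe_toNNReal hP, c01Norm]
  · rw [ENNReal.coe_toNNReal_eq_toReal, ← Real.norm_eq_abs, ← toReal_enorm]
    exact ENNReal.toReal_mono hS (le_iSup (fun x => ‖φ x‖ₑ) x)
  · rcases eq_or_ne x y with rfl | hxy
    · simp
    · have hxy0 : ‖x - y‖ₑ ≠ 0 := by simpa [sub_eq_zero] using hxy
      have h1 : ‖φ x - φ y‖ₑ / ‖x - y‖ₑ ≤ ⨆ x, ⨆ y, ‖φ x - φ y‖ₑ / ‖x - y‖ₑ :=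
        le_iSup₂ (f := fun x y => ‖φ x - φ y‖ₑ / ‖x - y‖ₑ) x y
      rw [ENNReal.div_le_iff hxy0 enorm_ne_top] at h1
      have h2 := ENNReal.toReal_mono (ENNReal.mul_ne_top hP enorm_ne_top) h1
      rw [ENNReal.toReal_mul, toReal_enorm, toReal_enorm] at h2
      exact (le_abs_self _).trans h2

/-- Lipschitz continuity of viscosity solutions of the obstacle problem in space and time. -/
theorem IsViscositySolution.abs_sub_le {n : ℕ} {s lam Lam T : ℝ}
    {K φ : EuclideanSpace ℝ (Fin n) → ℝ} {u : EuclideanSpace ℝ (Fin n) → ℝ → ℝ} (hn : 1 ≤ n)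
    (hs : s ∈ Ioo (0 : ℝ) (1 / 2)) (hK : IsEllipticKernel n s lam Lam K) (hlam : 0 < lam)
    (hLam : lam ≤ Lam) (hu : IsViscositySolution K φ T u) {S P : ℝ} (hS : ∀ x, |φ x| ≤ S)
    (hP0 : 0 ≤ P) (hP : ∀ x y, φ x - φ y ≤ P * ‖x - y‖) (x y : EuclideanSpace ℝ (Fin n))
    {t τ : ℝ} (ht : t ∈ Ico 0 T) (hτ : τ ∈ Ico 0 T) :
    |u x t - u y τ| ≤
      (S + P) * ‖x - y‖ + 2 * (Lam * truncatedMoment n s) * (S + P) * |t - τ| := by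
  have hS0 : 0 ≤ S := (abs_nonneg _).trans (hS x)
  have hLam0 : 0 < Lam := hlam.trans_le hLam
  have hJ := truncatedMoment_nonneg n s
  have hC : 0 ≤ Lam * ((S + P) * truncatedMoment n s) := by positivity
  have key : ∀ (x y : EuclideanSpace ℝ (Fin n)) (t τ : ℝ), t ∈ Ico 0 T → τ ∈ Ico 0 T →
      u x t - u y τ ≤
        (S + P) * ‖x - y‖ + 2 * (Lam * truncatedMoment n s) * (S + P) * |t - τ| := by
    intro x y t τ ht hτ
    have hlim : Tendsto (fun ε : ℝ => (S + P) * (‖x - y‖ + ε) +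
        Lam * ((S + P) * truncatedMoment n s) * (2 * |t - τ| + ε)) (𝓝[>] 0)
        (𝓝 ((S + P) * (‖x - y‖ + 0) +
          Lam * ((S + P) * truncatedMoment n s) * (2 * |t - τ| + 0))) :=
      ((by fun_prop : Continuous fun ε : ℝ => (S + P) * (‖x - y‖ + ε) +
        Lam * ((S + P) * truncatedMoment n s) * (2 * |t - τ| + ε)).tendsto 0).mono_left
          nhdsWithin_le_nhds
    have h := ge_of_tendsto hlim (b := u x t - u y τ) (by
      filter_upwards [self_mem_nhdsWithin] with ε hε
      refine (hu.sub_le_smoothCone_add hn hs hK hlam hLam hS hP0 hP hε x y ht hτ).trans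
        (add_le_add (smoothCone_le (by positivity) hε _) (mul_le_mul_of_nonneg_left ?_ hC))
      have := timeModulus_le hε (t - τ)
      have : max (t - τ) 0 ≤ |t - τ| := max_le (le_abs_self _) (abs_nonneg _)
      linarith)
    refine h.trans_eq ?_
    ring
  refine abs_sub_le_iff.2 ⟨key x y t τ ht hτ, ?_⟩
  rw [norm_sub_rev, abs_sub_comm]
  exact key y x τ t hτ ht

theorem mainTheorem9 (n : ℕ) (hn : 1 ≤ n) (s : ℝ) (hs : s ∈ Set.Ioo (0 : ℝ) (1 / 2))
    (lam Lam : ℝ) (hlam : 0 < lam) (hLam : lam ≤ Lam) :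
    ∃ C : ℝ≥0, ∀ K : EuclideanSpace ℝ (Fin n) → ℝ, IsEllipticKernel n s lam Lam K →
      ∀ T : ℝ, 0 < T →
      ∀ φ : EuclideanSpace ℝ (Fin n) → ℝ, MemC01c φ →
      ∀ u : EuclideanSpace ℝ (Fin n) → ℝ → ℝ, IsViscositySolution K φ T u →
        (∃ M : ℝ≥0, LipschitzOnWith M (fun p : EuclideanSpace ℝ (Fin n) × ℝ => u p.1 p.2)
          (univ ×ˢ Ioo 0 T)) ∧
        (∀ᵐ p ∂(cylMeasure n T),
          DifferentiableAt ℝ (fun q : EuclideanSpace ℝ (Fin n) × ℝ => u q.1 q.2) p) ∧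
        eLpNorm (fun p : EuclideanSpace ℝ (Fin n) × ℝ => gradient (fun x => u x p.2) p.1) ⊤
          (cylMeasure n T) ≤ c01Norm φ ∧
        eLpNorm (fun p : EuclideanSpace ℝ (Fin n) × ℝ => deriv (fun t => u p.1 t) p.2) ⊤
          (cylMeasure n T) ≤ C * c01Norm φ := by
  have hC : 0 ≤ 2 * (Lam * truncatedMoment n s) := by
    have := truncatedMoment_nonneg n s
    have := hlam.trans_le hLam
    positivity
  -- The factor `2` comes from `timeModulus`, which tends to twice the positive part as `ε → 0`.
  lift 2 * (Lam * truncatedMoment n s) to ℝ≥0 using hC with C hCeq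
  refine ⟨C, fun K hK T _ φ hφ u hu => ?_⟩
  obtain ⟨S, P, hnorm, hS, hP⟩ := hφ.exists_bounds
  have key : ∀ (x y : EuclideanSpace ℝ (Fin n)) (t τ : ℝ), t ∈ Ioo 0 T → τ ∈ Ioo 0 T →
      |u x t - u y τ| ≤ (S + P : ℝ≥0) * ‖x - y‖ + (C * (S + P) : ℝ≥0) * |t - τ| := by
    intro x y t τ ht hτ
    have h := hu.abs_sub_le hn hs hK hlam hLam hS P.coe_nonneg hP x y
      (Ioo_subset_Ico_self ht) (Ioo_subset_Ico_self hτ)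
    rw [← hCeq] at h
    push_cast
    exact h
  have hlip : LipschitzOnWith ((S + P) + C * (S + P))
      (fun p : EuclideanSpace ℝ (Fin n) × ℝ => u p.1 p.2) (univ ×ˢ Ioo 0 T) := by
    refine LipschitzOnWith.of_dist_le_mul fun p hp q hq => ?_
    have h := key p.1 q.1 p.2 q.2 hp.2 hq.2
    rw [← Real.dist_eq, ← Real.dist_eq, ← dist_eq_norm] at h
    refine h.trans ?_
    rw [NNReal.coe_add (S + P), add_mul, Prod.dist_eq]
    exact add_le_add (mul_le_mul_of_nonneg_left (le_max_left _ _) (NNReal.coe_nonneg _))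
      (mul_le_mul_of_nonneg_left (le_max_right _ _) (NNReal.coe_nonneg _))
  have hopen : IsOpen ((univ : Set (EuclideanSpace ℝ (Fin n))) ×ˢ Ioo 0 T) :=
    isOpen_univ.prod isOpen_Ioo
  have hmem : ∀ᵐ p ∂(cylMeasure n T), p ∈ (univ : Set (EuclideanSpace ℝ (Fin n))) ×ˢ Ioo 0 T :=
    ae_restrict_mem hopen.measurableSet
  have : (volume : Measure (EuclideanSpace ℝ (Fin n) × ℝ)).IsAddHaarMeasure := by
    rw [Measure.volume_eq_prod]
    infer_instance
  refine ⟨⟨_, hlip⟩, ?_, ?_, ?_⟩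
  · filter_upwards [hmem, hlip.ae_differentiableWithinAt (μ := volume) hopen.measurableSet]
      with p hp hd
    exact hd.differentiableAt (hopen.mem_nhds hp)
  · rw [hnorm, eLpNorm_exponent_top]
    refine eLpNormEssSup_le_of_ae_nnnorm_bound ?_
    filter_upwards [hmem] with p hp
    rw [← NNReal.coe_le_coe, coe_nnnorm,
      ← (InnerProductSpace.toDual ℝ (EuclideanSpace ℝ (Fin n))).norm_map, toDual_gradient]
    -- The bound needs no differentiability: the derivative is zero by convention where it does not
    -- exist.
    refine norm_fderiv_le_of_lip' ℝ (NNReal.coe_nonneg _) (Eventually.of_forall fun x => ?_)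
    simpa using key x p.1 p.2 p.2 hp.2 hp.2
  · rw [hnorm, eLpNorm_exponent_top, ← ENNReal.coe_mul]
    refine eLpNormEssSup_le_of_ae_nnnorm_bound ?_
    filter_upwards [hmem] with p hp
    rw [← NNReal.coe_le_coe, coe_nnnorm]
    refine norm_deriv_le_of_lip' (NNReal.coe_nonneg _) ?_
    filter_upwards [isOpen_Ioo.mem_nhds hp.2] with t ht
    simpa using key p.1 p.1 t p.2 ht hp.2
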